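/- Let $(X,g)$ be an admissible Riemannian polyhedron of dimension $m$: $X$ is connected and triangulated by a locally finite simplicial complex all of whose maximal simplices have dimension $m$, removing the $(m-2)$-skeleton from a connected open set leaves it connected, and every maximal simplex carries a Riemannian metric that is continuous up to the boundary. Let $N$ and $P$ be Hermitian manifolds without boundary, $P$ non-empty and $\dim_{\mathbb C}P=p\ge 1$. For an open set $O\subseteq X$ and a Hermitian manifold $M$, a map $f:O\to M$ is called *pseudo-horizontally weakly conformal* (PHWC) if it is continuous, of class $W^{1,2}_{\mathrm{loc}}(O,M)$ (locally of finite Korevaar–Schoen energy with respect to the intrinsic distance and volume of $X$ and the Riemannian distance of $M$), and if for any two local holomorphic functions $v=v_1+iv_2$, $w=w_1+iw_2$ (holomorphic functions on open subsets of $M$) $$\langle\nabla(w_1\circ f),\nabla(v_1\circ f)\rangle-\langle\nabla(w_2\circ f),\nabla(v_2\circ f)\rangle=0,\qquad \langle\nabla(w_2\circ f),\nabla(v_1\circ f)\rangle+\langle\nabla(w_1\circ f),\nabla(v_2\circ f)\rangle=0$$ almost everywhere on the set where $v\circ f$ and $w\circ f$ are both defined; here $\nabla$ is the weak gradient on the open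 maximal simplices of $X$. Let $\varphi:X\to N$ be a continuous map of class $W^{1,2}_{\mathrm{loc}}(X,N)$. Then $\varphi$ is PHWC if and only if, for every open set $A\subseteq N$ and every holomorphic map $\psi:A\to P$, the map $\psi\circ\varphi:\varphi^{-1}(A)\to P$ is PHWC. -/

import Mathlib

open Set Filter Topology MeasureTheory Manifold Bundle
open scoped ENNReal NNReal ContDiff

noncomputable section

/-! ### Riemannian polyhedra -/

/-- A polyhedron `X` of homogeneous dimension `m`, triangulated by a locally finite simplicial
complex `K` lying in a Euclidean space `V = ℝ^d`, with a Riemannian metric that is continuous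
up to the boundary on every maximal simplex (no compatibility along common faces is required).

Local finiteness is required at every point of the underlying space `K.space`, so that the subspace
topology of `K.space` is the usual topology of the complex; in particular `X` is locally
compact, separable and Hausdorff. The bilinear form `g s y` only matters for a maximal simplex `s`,
a point `y` of `s`, and vectors tangent to `s`. -/
structure RiemannianPolyhedron (X : Type*) [TopologicalSpace X] (m : ℕ) where
  d : ℕ
  K : Geometry.SimplicialComplex ℝ (EuclideanSpace ℝ (Fin d))
  locallyFinite : ∀ y ∈ K.space, ∃ U ∈ 𝓝 y,
    {s ∈ K.faces | (convexHull ℝ (s : Set (EuclideanSpace ℝ (Fin d))) ∩ U).Nonempty}.Finite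
  homogeneous : ∀ s ∈ K.faces, ∃ t ∈ K.faces, s ⊆ t ∧ t.card = m + 1
  θ : K.space ≃ₜ X
  connected : ConnectedSpace X
  g : Finset (EuclideanSpace ℝ (Fin d)) → EuclideanSpace ℝ (Fin d) →
    LinearMap.BilinForm ℝ (EuclideanSpace ℝ (Fin d))
  g_symm : ∀ s ∈ K.faces, s.card = m + 1 →
    ∀ y ∈ convexHull ℝ (s : Set (EuclideanSpace ℝ (Fin d))),
    ∀ a ∈ vectorSpan ℝ (s : Set (EuclideanSpace ℝ (Fin d))),
    ∀ b ∈ vectorSpan ℝ (s : Set (EuclideanSpace ℝ (Fin d))), g s y a b = g s y b a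
  g_pos : ∀ s ∈ K.faces, s.card = m + 1 →
    ∀ y ∈ convexHull ℝ (s : Set (EuclideanSpace ℝ (Fin d))),
    ∀ a ∈ vectorSpan ℝ (s : Set (EuclideanSpace ℝ (Fin d))), a ≠ 0 → 0 < g s y a a
  g_cont : ∀ s ∈ K.faces, s.card = m + 1 →
    ∀ a ∈ vectorSpan ℝ (s : Set (EuclideanSpace ℝ (Fin d))),
    ∀ b ∈ vectorSpan ℝ (s : Set (EuclideanSpace ℝ (Fin d))),
    ContinuousOn (fun y ↦ g s y a b) (convexHull ℝ (s : Set (EuclideanSpace ℝ (Fin d))))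

/-- The open standard `m`-simplex in `ℝ^m`. -/
def openSimplex (m : ℕ) : Set (EuclideanSpace ℝ (Fin m)) :=
  {x | (∀ i, 0 < x i) ∧ ∑ i, x i < 1}

namespace RiemannianPolyhedron

variable {X : Type*} [TopologicalSpace X] {m : ℕ} (R : RiemannianPolyhedron X m)

/-- The Euclidean space in which the complex lies. -/
abbrev V : Type := EuclideanSpace ℝ (Fin R.d)

/-- The maximal simplices. -/
abbrev Cell : Type := {s : Finset R.V // s ∈ R.K.faces ∧ s.card = m + 1}

/-- The homeomorphism `θ`, extended arbitrarily outside the underlying space of the complex. -/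
def toX (y : R.V) : X :=
  Function.extend Subtype.val R.θ (fun _ ↦ R.connected.toNonempty.some) y

/-- The inverse of the triangulation, with values in the ambient Euclidean space. -/
def toV (p : X) : R.V := (R.θ.symm p : R.V)

/-- The vertices `v_0, …, v_m` of a maximal simplex, in an arbitrarily fixed order. -/
def vertex (s : R.Cell) (i : Fin (m + 1)) : R.V :=
  ((s.1.equivFinOfCardEq s.2.2).symm i : R.V)

/-- The edge vectors `v_i - v_0`, `i = 1, …, m`. -/
def edge (s : R.Cell) (i : Fin m) : R.V := R.vertex s i.succ - R.vertex s 0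

/-- The affine parametrization `x ↦ v_0 + ∑ x_i (v_i - v_0)` of the affine span of a maximal
simplex; it maps the open standard simplex onto the open simplex. -/
def chart (s : R.Cell) (x : EuclideanSpace ℝ (Fin m)) : R.V :=
  R.vertex s 0 + ∑ i, x i • R.edge s i

/-- The induced parametrization of the simplex as a subset of `X`. -/
def pt (s : R.Cell) (x : EuclideanSpace ℝ (Fin m)) : X := R.toX (R.chart s x)

/-- The open maximal simplex as a subset of `X`. -/
def openCell (s : R.Cell) : Set X := R.pt s '' openSimplex m

/-- The part of the open standard simplex that is mapped into `O ⊆ X`. -/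
def dom (s : R.Cell) (O : Set X) : Set (EuclideanSpace ℝ (Fin m)) :=
  {x ∈ openSimplex m | R.pt s x ∈ O}

/-- The matrix `(g_ij)` of the metric in the affine coordinates of a maximal simplex. -/
def gram (s : R.Cell) (x : EuclideanSpace ℝ (Fin m)) : Matrix (Fin m) (Fin m) ℝ :=
  Matrix.of fun i j ↦ R.g s.1 (R.chart s x) (R.edge s i) (R.edge s j)

/-- The union of the closed simplices of dimension at most `k - 1`, that is, with at most `k`
vertices, as a subset of `X`. -/
def skeletonCard (k : ℕ) : Set X :=
  {p | ∃ s ∈ R.K.faces, s.card ≤ k ∧ R.toV p ∈ convexHull ℝ (s : Set R.V)}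

/-- Admissibility: removing the `(m - 2)`-skeleton (the simplices with at most `m - 1` vertices; it
is empty if `m ≤ 1`) from a connected open set leaves a connected set. Dimensional homogeneity is
part of `RiemannianPolyhedron`. -/
def Admissible : Prop :=
  ∀ U : Set X, IsOpen U → IsConnected U → IsConnected (U \ R.skeletonCard (m - 1))

/-- Null sets: the trace on every maximal simplex has Lebesgue measure zero. -/
def IsNull (Z : Set X) : Prop :=
  ∀ s : R.Cell, volume {x ∈ openSimplex m | R.pt s x ∈ Z} = 0

/-- The volume measure `μ_g`: the measure `√(det g_ij) dx` on every open maximal simplex. -/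
def vol [MeasurableSpace X] : Measure X :=
  Measure.sum fun s : R.Cell ↦ Measure.map (R.pt s)
    ((volume.restrict (openSimplex m)).withDensity
      fun x ↦ ENNReal.ofReal (Real.sqrt (R.gram s x).det))

/-- The length `L(γ)` of a path `γ : [0, 1] → X`: the sum over the maximal simplices of the
integrals of `√(g(γ', γ'))` over the times spent in the open simplex. -/
def pathLength (γ : ℝ → X) : ℝ≥0∞ :=
  ∑' s : R.Cell, ∫⁻ t in {t ∈ Icc (0 : ℝ) 1 | γ t ∈ R.openCell s},
    ENNReal.ofReal (Real.sqrt (R.g s.1 (R.toV (γ t))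
      (deriv (fun τ ↦ R.toV (γ τ)) t) (deriv (fun τ ↦ R.toV (γ τ)) t)))

/-- `γ` is a Lipschitz path from `p` to `q` which is transversal to `Z`, i.e. spends zero time
in `Z`. -/
structure IsPath (Z : Set X) (p q : X) (γ : ℝ → X) : Prop where
  lipschitz : ∃ C : ℝ≥0, LipschitzOnWith C (fun t ↦ R.toV (γ t)) (Icc 0 1)
  source : γ 0 = p
  target : γ 1 = q
  transversal : volume {t ∈ Icc (0 : ℝ) 1 | γ t ∈ Z} = 0

/-- The intrinsic distance `d_X(p, q) = sup_Z inf_γ L(γ)`, where `Z` runs through the null sets which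
contain the complement of the set of Lebesgue points of the metric in the open maximal simplices
(the metric being continuous, this complement is the complement of the union of the open
maximal simplices), and `γ` through the Lipschitz paths from `p` to `q` transversal to `Z`. -/
def xdist (p q : X) : ℝ≥0∞ :=
  ⨆ (Z : Set X) (_ : R.IsNull Z) (_ : (⋃ s, R.openCell s)ᶜ ⊆ Z),
    ⨅ (γ : ℝ → X) (_ : R.IsPath Z p q γ), R.pathLength γ

/-- `D` is the weak differential `(∂_1 u, …, ∂_m u)` of the function `u` on the part of the open
maximal simplex `s` lying in `O`, in the affine coordinates of `s`. -/
structure IsWeakDiff (O : Set X) (u : X → ℝ) (s : R.Cell)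
    (D : EuclideanSpace ℝ (Fin m) → EuclideanSpace ℝ (Fin m)) : Prop where
  locInt : LocallyIntegrableOn (fun x ↦ u (R.pt s x)) (R.dom s O)
  locInt_diff : LocallyIntegrableOn D (R.dom s O)
  byParts : ∀ η : EuclideanSpace ℝ (Fin m) → ℝ, ContDiff ℝ ∞ η → HasCompactSupport η →
    tsupport η ⊆ R.dom s O → ∀ i : Fin m,
      ∫ x, u (R.pt s x) * fderiv ℝ η x (EuclideanSpace.single i 1) = - ∫ x, D x i * η x

/-- The inner product `⟨∇u, ∇w⟩ = ∑ g^{ij} ∂_i u ∂_j w` of the gradients of two functions with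
differentials `a`, `b` at the point of the maximal simplex `s` with coordinates `x`. -/
def gradInner (s : R.Cell) (x : EuclideanSpace ℝ (Fin m)) (a b : EuclideanSpace ℝ (Fin m)) : ℝ :=
  ∑ i, ∑ j, (R.gram s x)⁻¹ i j * a i * b j

end RiemannianPolyhedron

/-! ### Hermitian manifolds -/

/-- The smooth (real) manifold underlying a complex manifold. -/
instance IsManifold.real_of_complex {n : ℕ} {N : Type*} [TopologicalSpace N]
    [ChartedSpace (EuclideanSpace ℂ (Fin n)) N]
    [IsManifold 𝓘(ℂ, EuclideanSpace ℂ (Fin n)) ω N] :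
    IsManifold 𝓘(ℝ, EuclideanSpace ℂ (Fin n)) ∞ N := by
  refine isManifold_of_contDiffOn _ _ _ fun e e' he he' ↦ ?_
  have h := (contDiffGroupoid ω 𝓘(ℂ, EuclideanSpace ℂ (Fin n))).compatible he he'
  rw [contDiffGroupoid, mem_groupoid_of_pregroupoid] at h
  exact (ContDiffOn.of_le h.1 le_top).restrict_scalars ℝ

/-- The complex structure `J` of a complex manifold on the real tangent spaces: multiplication by
the imaginary unit. -/
def complexStructure {n : ℕ} {N : Type*} [TopologicalSpace N]
    [ChartedSpace (EuclideanSpace ℂ (Fin n)) N] (x : N)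
    (a : TangentSpace 𝓘(ℝ, EuclideanSpace ℂ (Fin n)) x) :
    TangentSpace 𝓘(ℝ, EuclideanSpace ℂ (Fin n)) x :=
  (Complex.I • (show EuclideanSpace ℂ (Fin n) from a) : EuclideanSpace ℂ (Fin n))

/-- A Hermitian manifold of complex dimension `n`: a complex manifold with a smooth Riemannian metric
for which the complex structure is isometric. -/
class IsHermitianManifold (n : ℕ) (N : Type*) [TopologicalSpace N]
    [ChartedSpace (EuclideanSpace ℂ (Fin n)) N]
    [RiemannianBundle (fun x : N ↦ TangentSpace 𝓘(ℝ, EuclideanSpace ℂ (Fin n)) x)] : Prop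
    extends IsManifold 𝓘(ℂ, EuclideanSpace ℂ (Fin n)) ω N where
  smooth : IsContMDiffRiemannianBundle 𝓘(ℝ, EuclideanSpace ℂ (Fin n)) ∞ (EuclideanSpace ℂ (Fin n))
    (fun x : N ↦ TangentSpace 𝓘(ℝ, EuclideanSpace ℂ (Fin n)) x)
  hermitian : ∀ (x : N) (a b : TangentSpace 𝓘(ℝ, EuclideanSpace ℂ (Fin n)) x),
    inner ℝ (complexStructure x a) (complexStructure x b) = inner ℝ a b

/-! ### Maps of locally finite energy and pseudo-horizontally weakly conformal maps -/

section Maps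

variable {X : Type*} [TopologicalSpace X] [MeasurableSpace X] {m : ℕ}
  (R : RiemannianPolyhedron X m) (n : ℕ) {N : Type*} [TopologicalSpace N]
  [ChartedSpace (EuclideanSpace ℂ (Fin n)) N]
  [RiemannianBundle (fun x : N ↦ TangentSpace 𝓘(ℝ, EuclideanSpace ℂ (Fin n)) x)]

/-- The Riemannian distance of the target manifold. -/
def ndist (y z : N) : ℝ≥0∞ := riemannianEDist 𝓘(ℝ, EuclideanSpace ℂ (Fin n)) y z

/-- The approximate energy density `e_ε(φ)(p) = ∫_{B(p, ε)} d(φ(p), φ(q))² / ε^(m+2) dμ_g(q)` of the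
restriction of `φ` to `U`. -/
def approxEnergyDensity (φ : X → N) (U : Set X) (ε : ℝ) (p : X) : ℝ≥0∞ :=
  ∫⁻ q in {q ∈ U | R.xdist p q < ENNReal.ofReal ε},
    ndist n (φ p) (φ q) ^ 2 / ENNReal.ofReal (ε ^ (m + 2)) ∂(R.vol)

/-- The Korevaar–Schoen energy of the restriction of `φ` to the open set `U`: the supremum, over the
continuous `f : U → [0, 1]` with compact support, of `limsup_{ε → 0} ∫_U f e_ε(φ) dμ_g`. -/
def energyOn (φ : X → N) (U : Set X) : ℝ≥0∞ :=
  ⨆ (f : X → ℝ≥0) (_ : Continuous f) (_ : ∀ p, f p ≤ 1) (_ : HasCompactSupport f)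
    (_ : tsupport f ⊆ U),
    limsup (fun ε : ℝ ↦ ∫⁻ p in U, f p * approxEnergyDensity R n φ U ε p ∂(R.vol)) (𝓝[>] 0)

/-- The restriction of `φ` to `U` is in `L²_loc(U, N)`. -/
def MemL2LocOn (φ : X → N) (U : Set X) : Prop :=
  AEStronglyMeasurable φ (R.vol.restrict U) ∧
    ∃ y : N, ∀ C : Set X, IsCompact C → C ⊆ U → ∫⁻ p in C, ndist n (φ p) y ^ 2 ∂(R.vol) < ⊤

/-- `φ` is of class `W^{1,2}_loc(O, N)`: the open set `O` is covered by open sets `U` on which the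
energy is finite. -/
def MemW12LocOn (φ : X → N) (O : Set X) : Prop :=
  ∀ p ∈ O, ∃ U : Set X, IsOpen U ∧ p ∈ U ∧ U ⊆ O ∧ MemL2LocOn R n φ U ∧ energyOn R n φ U < ⊤

/-- `φ` is pseudo-horizontally weakly conformal on the open set `O` (values of `φ` outside `O` play
no role): it is continuous and of class `W^{1,2}_loc` on `O`, and for any two local holomorphic
functions `v = v₁ + i v₂`, `w = w₁ + i w₂` on the target,
`⟨∇(w₁∘φ), ∇(v₁∘φ)⟩ - ⟨∇(w₂∘φ), ∇(v₂∘φ)⟩ = 0` and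
`⟨∇(w₂∘φ), ∇(v₁∘φ)⟩ + ⟨∇(w₁∘φ), ∇(v₂∘φ)⟩ = 0` almost everywhere where both are defined.
The weak gradients of `v₁∘φ, …, w₂∘φ` are unique up to null sets, so `dv₁, …, dw₂` below stand for
*the* weak differentials; they exist because `φ` is continuous and of class `W^{1,2}_loc`. -/
structure IsPHWCOn (φ : X → N) (O : Set X) : Prop where
  continuousOn : ContinuousOn φ O
  memW12Loc : MemW12LocOn R n φ O
  conformal : ∀ (A B : Set N) (v w : N → ℂ), IsOpen A → IsOpen B →
    MDifferentiableOn 𝓘(ℂ, EuclideanSpace ℂ (Fin n)) 𝓘(ℂ, ℂ) v A →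
    MDifferentiableOn 𝓘(ℂ, EuclideanSpace ℂ (Fin n)) 𝓘(ℂ, ℂ) w B →
    ∀ (s : R.Cell) (dv₁ dv₂ dw₁ dw₂ : EuclideanSpace ℝ (Fin m) → EuclideanSpace ℝ (Fin m)),
    R.IsWeakDiff (O ∩ φ ⁻¹' (A ∩ B)) (fun p ↦ (v (φ p)).re) s dv₁ →
    R.IsWeakDiff (O ∩ φ ⁻¹' (A ∩ B)) (fun p ↦ (v (φ p)).im) s dv₂ →
    R.IsWeakDiff (O ∩ φ ⁻¹' (A ∩ B)) (fun p ↦ (w (φ p)).re) s dw₁ →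
    R.IsWeakDiff (O ∩ φ ⁻¹' (A ∩ B)) (fun p ↦ (w (φ p)).im) s dw₂ →
    ∀ᵐ x : EuclideanSpace ℝ (Fin m), x ∈ R.dom s (O ∩ φ ⁻¹' (A ∩ B)) →
      R.gradInner s x (dw₁ x) (dv₁ x) - R.gradInner s x (dw₂ x) (dv₂ x) = 0 ∧
      R.gradInner s x (dw₂ x) (dv₁ x) + R.gradInner s x (dw₁ x) (dv₂ x) = 0

end Maps

end

/-! If `φ` is pseudo-horizontally weakly conformal and `ψ` is holomorphic, then local holomorphic
functions `v`, `w` on `P` pull back to local holomorphic functions `v ∘ ψ`, `w ∘ ψ` on `N`, and the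
conformality relations of `ψ ∘ φ` for `v`, `w` are those of `φ` for `v ∘ ψ`, `w ∘ ψ`. What has to be
shown is that `ψ ∘ φ` is again of class `W^{1,2}_loc` (`MemW12LocOn.comp_of_mdifferentiableOn`). This
holds because `ψ` is locally Lipschitz for the Riemannian distances
(`exists_ndist_le_mul_of_mdifferentiableOn`): in charts by the Schwarz lemma, and intrinsically because
the Riemannian distance is locally equivalent to the distance in a chart
(`exists_riemannianEDist_le_edist_extChartAt`, `exists_edist_extChartAt_le_riemannianEDist`). Local
square integrability uses that compact sets have finite volume
(`RiemannianPolyhedron.vol_lt_top_of_isCompact`).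

Conversely, let `h` be a local holomorphic function on `N`. On `{|h| < k}` the map which has a small
multiple of `h` as first coordinate in a chart of `P`, the other coordinates being constant, is
holomorphic with values in `P`. The relations for its composition with `φ` and the first coordinate
function say that the complex bilinear extension of the metric vanishes on the pair `(h, h)`
(`ae_gradInner_self_of_forall_comp`). Applying this to `v`, `w` and `v + w`, polarization gives the
relations for the pair `(v, w)`, as the extended metric is symmetric. -/

noncomputable section

/-! ### Complex differentiable maps are locally Lipschitz -/

/-- A complex differentiable map is locally Lipschitz. Near a point of continuity its oscillation is
bounded, so the Schwarz lemma bounds its derivative; continuity of the derivative is not needed. -/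
theorem DifferentiableOn.exists_lipschitzOnWith_of_complex {E F : Type*}
    [NormedAddCommGroup E] [NormedSpace ℂ E] [NormedAddCommGroup F] [NormedSpace ℂ F]
    {f : E → F} {c : E} {U : Set E} (hf : DifferentiableOn ℂ f U) (hU : U ∈ 𝓝 c) :
    ∃ K : ℝ≥0, ∃ V ∈ 𝓝 c, LipschitzOnWith K f V := by
  have hcont : ContinuousAt f c := hf.continuousOn.continuousAt hU
  have h1 : U ∩ f ⁻¹' Metric.ball (f c) (1 / 2) ∈ 𝓝 c :=
    inter_mem hU (hcont (Metric.ball_mem_nhds _ (by norm_num)))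
  obtain ⟨r, hr, hball⟩ := Metric.mem_nhds_iff.1 h1
  have key : ∀ z ∈ Metric.ball c (r / 2), DifferentiableAt ℂ f z ∧
      ‖fderiv ℂ f z‖ ≤ 1 / (r / 2) := by
    intro z hz
    have hsub : Metric.ball z (r / 2) ⊆ Metric.ball c r := by
      apply Metric.ball_subset_ball'
      rw [Metric.mem_ball] at hz
      linarith
    have hzr : z ∈ Metric.ball c r := hsub (Metric.mem_ball_self (by positivity))
    have hd : DifferentiableOn ℂ f (Metric.ball z (r / 2)) :=
      hf.mono fun y hy ↦ (hball (hsub hy)).1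
    refine ⟨hd.differentiableAt (Metric.ball_mem_nhds _ (by positivity)), ?_⟩
    refine Complex.norm_fderiv_le_div_of_mapsTo_ball hd (fun y hy ↦ ?_) (by positivity)
    have h2 := (hball (hsub hy)).2
    have h3 := (hball hzr).2
    rw [mem_preimage, Metric.mem_ball] at h2 h3
    rw [Metric.mem_closedBall]
    linarith [dist_triangle_right (f y) (f z) (f c)]
  refine ⟨Real.toNNReal (1 / (r / 2)), Metric.ball c (r / 2),
    Metric.ball_mem_nhds _ (by positivity), ?_⟩
  refine Convex.lipschitzOnWith_of_nnnorm_fderiv_le (𝕜 := ℂ) (fun z hz ↦ (key z hz).1)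
    (fun z hz ↦ ?_) (convex_ball _ _)
  rw [← NNReal.coe_le_coe, coe_nnnorm, Real.coe_toNNReal _ (by positivity)]
  exact (key z hz).2

/-! ### Charts and the Riemannian distance -/

section Riemannian

open Metric

variable {E : Type*} [NormedAddCommGroup E] [NormedSpace ℝ E]
  {H : Type*} [TopologicalSpace H] (I : ModelWithCorners ℝ E H)
  {M : Type*} [TopologicalSpace M] [ChartedSpace H M]
  [RiemannianBundle (fun x : M ↦ TangentSpace I x)]
  [IsManifold I 1 M] [IsContinuousRiemannianBundle E (fun x : M ↦ TangentSpace I x)]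

-- the norms of the model space on its tangent spaces, with respect to which the operator norms of the
-- derivatives of the charts are taken
attribute [local instance] normedAddCommGroupTangentSpaceVectorSpace
attribute [local instance] normedSpaceTangentSpaceVectorSpace

/-- The inverse of an extended chart is locally Lipschitz, uniformly in both points: segments in the
chart lift to paths of controlled length. -/
theorem exists_riemannianEDist_le_edist_extChartAt (x : M) :
    ∃ C : ℝ≥0, ∃ W ∈ 𝓝 x, ∀ y ∈ W, ∀ z ∈ W,
      riemannianEDist I y z ≤ C * edist (extChartAt I x y) (extChartAt I x z) := by
  rcases eventually_enorm_mfderivWithin_symm_extChartAt_lt I x with ⟨C, C_pos, hC⟩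
  obtain ⟨D, hD, hCD⟩ := hC.exists_mem
  obtain ⟨r, r_pos, hr⟩ : ∃ r > 0,
      ball (extChartAt I x x) r ∩ range I ⊆ (extChartAt I x).target ∩ D :=
    mem_nhdsWithin_iff.1 (inter_mem (extChartAt_target_mem_nhdsWithin x) hD)
  have A : (extChartAt I x) ⁻¹' (ball (extChartAt I x x) r ∩ range I) ∈ 𝓝 x := by
    apply extChartAt_preimage_mem_nhds_of_mem_nhdsWithin (by simp)
    rw [inter_comm]
    exact inter_mem_nhdsWithin _ (ball_mem_nhds _ r_pos)
  refine ⟨C, _, inter_mem A (chart_source_mem_nhds H x), ?_⟩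
  rintro y ⟨hy, h'y⟩ z ⟨hz, h'z⟩
  let η := ContinuousAffineMap.lineMap (R := ℝ) (extChartAt I x y) (extChartAt I x z)
  set γ := (extChartAt I x).symm ∘ η
  have hη : Icc 0 1 ⊆ ⇑η ⁻¹' ((extChartAt I x).target ∩ D) := by
    simp only [← image_subset_iff, ContinuousAffineMap.coe_lineMap_eq,
     ← segment_eq_image_lineMap, η]
    exact (((convex_ball _ _).inter I.convex_range).segment_subset hy hz).trans hr
  simp only [preimage_inter, subset_inter_iff] at hη
  have η_smooth : CMDiff[Icc 0 1] 1 η := by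
    apply ContMDiff.contMDiffOn
    rw [contMDiff_iff_contDiff]
    exact ContinuousAffineMap.contDiff _
  have : riemannianEDist I y z ≤ pathELength I γ 0 1 := by
    apply riemannianEDist_le_pathELength _ _ _ zero_le_one
    · exact (contMDiffOn_extChartAt_symm x).comp η_smooth hη.1
    · simp [γ, η, ContinuousAffineMap.coe_lineMap_eq, h'y]
    · simp [γ, η, ContinuousAffineMap.coe_lineMap_eq, h'z]
  apply this.trans
  rw [← lintegral_fderiv_lineMap_eq_edist, pathELength_eq_lintegral_mfderivWithin_Icc,
    ← lintegral_const_mul' _ _ ENNReal.coe_ne_top]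
  apply setLIntegral_mono' measurableSet_Icc (fun t ht ↦ ?_)
  have : mfderiv[Icc 0 1] γ t =
      (mfderiv[range I] (extChartAt I x).symm (η t)) ∘L (mfderiv[Icc 0 1] η t) := by
    apply mfderivWithin_comp
    · exact mdifferentiableWithinAt_extChartAt_symm (hη.1 ht)
    · exact η_smooth.mdifferentiableOn one_ne_zero t ht
    · exact hη.1.trans (preimage_mono (extChartAt_target_subset_range x))
    · rw [uniqueMDiffWithinAt_iff_uniqueDiffWithinAt]
      exact uniqueDiffOn_Icc zero_lt_one t ht
  have : mfderiv[Icc 0 1] γ t 1 =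
      (mfderiv[range I] (extChartAt I x).symm (η t)) (mfderiv[Icc 0 1] η t 1) := congr($this 1)
  rw [this]
  apply (ContinuousLinearMap.le_opENorm _ _).trans
  gcongr
  · exact (hCD _ (hη.2 ht)).le
  · simp only [mfderivWithin_eq_fderivWithin]
    exact le_of_eq rfl

/-- An extended chart is locally Lipschitz, uniformly in both points. Nearly minimal paths between
points of a small ball stay in a larger ball on which the derivative of the chart is bounded. -/
theorem exists_edist_extChartAt_le_riemannianEDist [RegularSpace M] (x : M) :
    ∃ C : ℝ≥0, ∃ W ∈ 𝓝 x, ∀ y ∈ W, ∀ z ∈ W,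
      edist (extChartAt I x y) (extChartAt I x z) ≤ C * riemannianEDist I y z := by
  rcases eventually_enorm_mfderiv_extChartAt_lt I x with ⟨C, C_pos, hC⟩
  obtain ⟨D, hD, hCD⟩ := hC.exists_mem
  obtain ⟨c, hc, hcs⟩ := setOfPred_riemannianEDist_lt_subset_nhds' I
    (inter_mem hD (chart_source_mem_nhds H x))
  have hc2 : 0 < c / 2 := ENNReal.div_pos hc.ne' (by simp)
  have hc4 : 0 < c / 2 / 2 := ENNReal.div_pos hc2.ne' (by simp)
  refine ⟨C, _, eventually_riemannianEDist_lt I x hc4, ?_⟩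
  intro y (hy : riemannianEDist I x y < _) z (hz : riemannianEDist I x z < _)
  have hyz : riemannianEDist I y z < c / 2 := by
    calc riemannianEDist I y z ≤ riemannianEDist I y x + riemannianEDist I x z :=
        riemannianEDist_triangle
      _ < c / 2 / 2 + c / 2 / 2 := by
        rw [riemannianEDist_comm (x := y)]
        exact ENNReal.add_lt_add hy hz
      _ = c / 2 := ENNReal.add_halves _
  have hyc : riemannianEDist I x y < c / 2 := hy.trans_le ENNReal.half_le_self
  -- it suffices to bound the distance in the chart by the lengths `r` of nearly minimal paths
  suffices H : ∀ r, riemannianEDist I y z < r → r ≤ c / 2 →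
      edist (extChartAt I x y) (extChartAt I x z) ≤ C * r by
    have hlim : Tendsto (fun r : ℝ≥0∞ ↦ C * r) (𝓝[>] (riemannianEDist I y z))
        (𝓝 (C * riemannianEDist I y z)) :=
      (ENNReal.continuous_const_mul ENNReal.coe_ne_top).continuousWithinAt
    have : (𝓝[>] (riemannianEDist I y z)).NeBot := nhdsGT_neBot_of_exists_gt ⟨_, hyz⟩
    refine ge_of_tendsto hlim ?_
    filter_upwards [Ioc_mem_nhdsGT hyz] with r hr using H r hr.1 hr.2
  intro r hr hrc
  rcases exists_lt_locally_constant_of_riemannianEDist_lt hr zero_lt_one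
    with ⟨γ, hγy, hγz, γ_smooth, hγ, -⟩
  -- the path stays in the ball of radius `c` around `x`
  have hmem : ∀ t ∈ Icc (0 : ℝ) 1, γ t ∈ D ∩ (chartAt H x).source := by
    intro t ht
    apply hcs
    calc riemannianEDist I x (γ t) ≤ riemannianEDist I x y + riemannianEDist I y (γ t) :=
        riemannianEDist_triangle
      _ ≤ riemannianEDist I x y + pathELength I γ 0 t := by
        gcongr
        exact riemannianEDist_le_pathELength γ_smooth.contMDiffOn hγy rfl ht.1
      _ ≤ riemannianEDist I x y + pathELength I γ 0 1 := by
        gcongr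
        exact ht.2
      _ < c / 2 + c / 2 := ENNReal.add_lt_add hyc (hγ.trans_le hrc)
      _ = c := ENNReal.add_halves _
  let γ' := extChartAt I x ∘ γ
  have hC : CMDiff[Icc 0 1] 1 γ' :=
    contMDiffOn_extChartAt.comp (I' := I) (t := (chartAt H x).source)
      γ_smooth.contMDiffOn (fun t' ht' ↦ (hmem t' ht').2)
  calc edist (extChartAt I x y) (extChartAt I x z)
    _ = ‖γ' 1 - γ' 0‖ₑ := by
      rw [edist_comm, edist_eq_enorm_sub]
      simp [γ', hγy, hγz]
    _ ≤ ∫⁻ t' in Icc 0 1, ‖derivWithin γ' (Icc 0 1) t'‖ₑ := by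
      apply enorm_sub_le_lintegral_derivWithin_Icc_of_contDiffOn_Icc _ zero_le_one
      rwa [← contMDiffOn_iff_contDiffOn]
    _ = ∫⁻ t' in Icc 0 1, ‖mfderiv[Icc 0 1] γ' t' 1‖ₑ := by
      simp_rw [← fderivWithin_derivWithin, mfderivWithin_eq_fderivWithin]
      rfl
    _ ≤ ∫⁻ t' in Icc 0 1, C * ‖mfderiv[Icc 0 1] γ t' 1‖ₑ := by
      apply setLIntegral_mono' measurableSet_Icc (fun t' ht' ↦ ?_)
      have : mfderiv[Icc 0 1] γ' t' =
          (mfderiv% (extChartAt I x) (γ t')) ∘L (mfderiv[Icc 0 1] γ t') := by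
        apply mfderiv_comp_mfderivWithin
        · exact mdifferentiableAt_extChartAt (hmem t' ht').2
        · exact (γ_smooth.mdifferentiable one_ne_zero).mdifferentiableOn _ ht'
        · rw [uniqueMDiffWithinAt_iff_uniqueDiffWithinAt]
          exact uniqueDiffOn_Icc zero_lt_one _ ht'
      have : mfderiv[Icc 0 1] γ' t' 1 =
          (mfderiv% (extChartAt I x) (γ t')) (mfderiv[Icc 0 1] γ t' 1) :=
        congr($this 1)
      rw [this]
      apply (ContinuousLinearMap.le_opENorm _ _).trans
      gcongr
      exact (hCD _ (hmem t' ht').1).le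
    _ = C * pathELength I γ 0 1 := by
      rw [lintegral_const_mul' _ _ ENNReal.coe_ne_top,
          pathELength_eq_lintegral_mfderivWithin_Icc]
    _ ≤ C * r := by
      gcongr

end Riemannian

/-! ### Holomorphic maps between Hermitian manifolds -/

section Holomorphic

variable {n p : ℕ} {N : Type*} [TopologicalSpace N]
  [ChartedSpace (EuclideanSpace ℂ (Fin n)) N]
  [RiemannianBundle (fun x : N ↦ TangentSpace 𝓘(ℝ, EuclideanSpace ℂ (Fin n)) x)]
  [IsHermitianManifold n N]
  {P : Type*} [TopologicalSpace P]
  [ChartedSpace (EuclideanSpace ℂ (Fin p)) P]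
  [RiemannianBundle (fun x : P ↦ TangentSpace 𝓘(ℝ, EuclideanSpace ℂ (Fin p)) x)]
  [IsHermitianManifold p P]

instance IsHermitianManifold.isManifold_real_one :
    IsManifold 𝓘(ℝ, EuclideanSpace ℂ (Fin n)) 1 N :=
  IsManifold.of_le (n := ∞) (by exact_mod_cast le_top)

theorem IsHermitianManifold.isContinuousRiemannianBundle (n : ℕ) (N : Type*) [TopologicalSpace N]
    [ChartedSpace (EuclideanSpace ℂ (Fin n)) N]
    [RiemannianBundle (fun x : N ↦ TangentSpace 𝓘(ℝ, EuclideanSpace ℂ (Fin n)) x)]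
    [IsHermitianManifold n N] :
    IsContinuousRiemannianBundle (EuclideanSpace ℂ (Fin n))
      (fun x : N ↦ TangentSpace 𝓘(ℝ, EuclideanSpace ℂ (Fin n)) x) := by
  obtain ⟨g, g_smooth, hg⟩ := (IsHermitianManifold.smooth (n := n) (N := N)).exists_contMDiff
  exact ⟨g, g_smooth.continuous, hg⟩

/-- Holomorphic maps are locally Lipschitz for the Riemannian distances. -/
theorem exists_ndist_le_mul_of_mdifferentiableOn [T2Space N] {ψ : N → P} {A : Set N} (hA : IsOpen A)
    (hψ : MDifferentiableOn 𝓘(ℂ, EuclideanSpace ℂ (Fin n)) 𝓘(ℂ, EuclideanSpace ℂ (Fin p)) ψ A)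
    {x : N} (hx : x ∈ A) :
    ∃ C : ℝ≥0, ∃ W ∈ 𝓝 x, ∀ y ∈ W, ∀ z ∈ W, ndist p (ψ y) (ψ z) ≤ C * ndist n y z := by
  have := IsHermitianManifold.isContinuousRiemannianBundle n N
  have := IsHermitianManifold.isContinuousRiemannianBundle p P
  have : LocallyCompactSpace N :=
    Manifold.locallyCompact_of_finiteDimensional 𝓘(ℝ, EuclideanSpace ℂ (Fin n))
  obtain ⟨C₁, W₁, hW₁, h₁⟩ :=
    exists_edist_extChartAt_le_riemannianEDist 𝓘(ℝ, EuclideanSpace ℂ (Fin n)) x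
  obtain ⟨C₂, W₂, hW₂, h₂⟩ :=
    exists_riemannianEDist_le_edist_extChartAt 𝓘(ℝ, EuclideanSpace ℂ (Fin p)) (ψ x)
  have hψc : ContinuousAt ψ x := hψ.continuousOn.continuousAt (hA.mem_nhds hx)
  set e := chartAt (EuclideanSpace ℂ (Fin n)) x with he
  set e' := chartAt (EuclideanSpace ℂ (Fin p)) (ψ x) with he'
  have hS : A ∩ ψ ⁻¹' e'.source ∈ 𝓝 x := inter_mem (hA.mem_nhds hx)
    (hψc (chart_source_mem_nhds _ _))
  have hU : e.target ∩ e.symm ⁻¹' (A ∩ ψ ⁻¹' e'.source) ∈ 𝓝 (e x) := by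
    refine inter_mem (chart_target_mem_nhds _ _) ?_
    apply (e.continuousAt_symm (mem_chart_target _ x)).preimage_mem_nhds
    rwa [e.left_inv (mem_chart_source _ x)]
  have hd : DifferentiableOn ℂ (e' ∘ ψ ∘ e.symm)
      (e.target ∩ e.symm ⁻¹' (A ∩ ψ ⁻¹' e'.source)) := by
    rintro a ⟨ha, hsA, hse⟩
    apply DifferentiableAt.differentiableWithinAt
    rw [← mdifferentiableAt_iff_differentiableAt]
    have h1 : MDifferentiableAt 𝓘(ℂ, EuclideanSpace ℂ (Fin n)) 𝓘(ℂ, EuclideanSpace ℂ (Fin n))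
        e.symm a := mdifferentiableAt_atlas_symm (chart_mem_atlas _ x) ha
    have h2 := (hψ _ hsA).mdifferentiableAt (hA.mem_nhds hsA)
    have h3 : MDifferentiableAt 𝓘(ℂ, EuclideanSpace ℂ (Fin p)) 𝓘(ℂ, EuclideanSpace ℂ (Fin p))
        e' (ψ (e.symm a)) := mdifferentiableAt_atlas (chart_mem_atlas _ _) hse
    exact h3.comp a (h2.comp a h1)
  obtain ⟨K, V, hV, hK⟩ := hd.exists_lipschitzOnWith_of_complex hU
  have hVx : e ⁻¹' V ∈ 𝓝 x := (e.continuousAt (mem_chart_source _ x)).preimage_mem_nhds hV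
  refine ⟨C₂ * (K * C₁), W₁ ∩ ψ ⁻¹' W₂ ∩ (e.source ∩ e ⁻¹' V),
    inter_mem (inter_mem hW₁ (hψc hW₂)) (inter_mem (chart_source_mem_nhds _ _) hVx), ?_⟩
  rintro y ⟨⟨hy₁, hy₂⟩, hye, hyV⟩ z ⟨⟨hz₁, hz₂⟩, hze, hzV⟩
  have hlip := hK hyV hzV
  simp only [Function.comp_apply, e.left_inv hye, e.left_inv hze] at hlip
  have h₁' := h₁ y hy₁ z hz₁
  have h₂' := h₂ _ hy₂ _ hz₂
  simp only [extChartAt, mfld_simps] at h₁' h₂'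
  calc ndist p (ψ y) (ψ z) ≤ C₂ * edist (e' (ψ y)) (e' (ψ z)) := h₂'
    _ ≤ C₂ * (K * edist (e y) (e z)) := by gcongr
    _ ≤ C₂ * (K * (C₁ * ndist n y z)) := by gcongr; exact h₁'
    _ = _ := by push_cast; ring

theorem eventually_ndist_lt_one (x : N) : ∀ᶠ y in 𝓝 x, ndist n y x < 1 := by
  have := IsHermitianManifold.isContinuousRiemannianBundle n N
  filter_upwards [eventually_riemannianEDist_lt 𝓘(ℝ, EuclideanSpace ℂ (Fin n)) x one_pos]
    with y hy
  rwa [ndist, riemannianEDist_comm]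

end Holomorphic

/-! ### Simplices, gradients and volume of a Riemannian polyhedron -/

namespace RiemannianPolyhedron

variable {X : Type*} [TopologicalSpace X] {m : ℕ} (R : RiemannianPolyhedron X m)

/-- The closed standard `m`-simplex in `ℝ^m`. -/
def closedSimplex (m : ℕ) : Set (EuclideanSpace ℝ (Fin m)) :=
  {x | (∀ i, 0 ≤ x i) ∧ ∑ i, x i ≤ 1}

theorem openSimplex_subset_closedSimplex : openSimplex m ⊆ closedSimplex m :=
  fun _ hx ↦ ⟨fun i ↦ (hx.1 i).le, hx.2.le⟩

theorem isOpen_openSimplex : IsOpen (openSimplex m) := by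
  have h : openSimplex m = (⋂ i, {x | 0 < x i}) ∩ {x | ∑ i, x i < 1} := by
    ext x; simp [openSimplex]
  rw [h]
  refine (isOpen_iInter_of_finite fun i ↦ ?_).inter ?_
  · exact isOpen_lt continuous_const (by fun_prop)
  · exact isOpen_lt (by fun_prop) continuous_const

theorem isCompact_closedSimplex : IsCompact (closedSimplex m) := by
  have hclosed : IsClosed (closedSimplex m) := by
    have h : closedSimplex m = (⋂ i, {x | 0 ≤ x i}) ∩ {x | ∑ i, x i ≤ 1} := by
      ext x; simp [closedSimplex]
    rw [h]
    refine (isClosed_iInter fun i ↦ ?_).inter ?_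
    · exact isClosed_le continuous_const (by fun_prop)
    · exact isClosed_le (by fun_prop) continuous_const
  refine IsCompact.of_isClosed_subset
    ((isCompact_Icc (a := (0 : Fin m → ℝ)) (b := 1)).image (PiLp.continuous_toLp 2 _)) hclosed ?_
  intro x hx
  refine ⟨x.ofLp, ⟨fun i ↦ hx.1 i, fun i ↦ ?_⟩, rfl⟩
  exact (Finset.single_le_sum (fun j _ ↦ hx.1 j) (Finset.mem_univ i)).trans hx.2

theorem vertex_mem (s : R.Cell) (i : Fin (m + 1)) : R.vertex s i ∈ s.1 :=
  ((s.1.equivFinOfCardEq s.2.2).symm i).2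

theorem edge_mem_vectorSpan (s : R.Cell) (i : Fin m) :
    R.edge s i ∈ vectorSpan ℝ (s.1 : Set R.V) :=
  vsub_mem_vectorSpan ℝ (R.vertex_mem s _) (R.vertex_mem s _)

theorem continuous_chart (s : R.Cell) : Continuous (R.chart s) := by
  unfold chart; fun_prop

theorem chart_mem_convexHull (s : R.Cell) {x : EuclideanSpace ℝ (Fin m)}
    (hx : x ∈ closedSimplex m) : R.chart s x ∈ convexHull ℝ (s.1 : Set R.V) := by
  have h := (convex_convexHull ℝ (s.1 : Set R.V)).sum_mem (t := Finset.univ)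
    (w := (Fin.cons (1 - ∑ i, x i) x.ofLp : Fin (m + 1) → ℝ)) (z := R.vertex s)
    (fun i _ ↦ by
      refine Fin.cases ?_ (fun j ↦ ?_) i
      · simpa using hx.2
      · simpa using hx.1 j)
    (by simp [Fin.sum_univ_succ]) (fun i _ ↦ subset_convexHull ℝ _ (R.vertex_mem s i))
  convert h using 1
  simp only [chart, edge, smul_sub, Finset.sum_sub_distrib, Fin.sum_univ_succ, Fin.cons_zero,
    Fin.cons_succ, sub_smul, one_smul, Finset.sum_smul]
  abel

theorem chart_mem_space (s : R.Cell) {x : EuclideanSpace ℝ (Fin m)}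
    (hx : x ∈ closedSimplex m) : R.chart s x ∈ R.K.space :=
  R.K.convexHull_subset_space s.2.1 (R.chart_mem_convexHull s hx)

theorem pt_eq (s : R.Cell) {x : EuclideanSpace ℝ (Fin m)} (hx : x ∈ closedSimplex m) :
    R.pt s x = R.θ ⟨R.chart s x, R.chart_mem_space s hx⟩ := by
  rw [pt, toX]
  exact Subtype.val_injective.extend_apply R.θ _ ⟨R.chart s x, R.chart_mem_space s hx⟩

theorem toV_pt (s : R.Cell) {x : EuclideanSpace ℝ (Fin m)} (hx : x ∈ closedSimplex m) :
    R.toV (R.pt s x) = R.chart s x := by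
  rw [R.pt_eq s hx, toV, Homeomorph.symm_apply_apply]

theorem continuousOn_pt (s : R.Cell) : ContinuousOn (R.pt s) (openSimplex m) := by
  rw [continuousOn_iff_continuous_domRestrict]
  have h : (openSimplex m).domRestrict (R.pt s) = fun x : openSimplex m ↦ R.θ ⟨R.chart s x,
      R.chart_mem_space s (openSimplex_subset_closedSimplex x.2)⟩ := by
    ext x
    exact R.pt_eq s (openSimplex_subset_closedSimplex x.2)
  rw [h]
  exact R.θ.continuous.comp
    (((R.continuous_chart s).comp continuous_subtype_val).subtype_mk _)

theorem isOpen_dom (s : R.Cell) {O : Set X} (hO : IsOpen O) : IsOpen (R.dom s O) :=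
  (R.continuousOn_pt s).isOpen_inter_preimage isOpen_openSimplex hO

theorem dom_mono (s : R.Cell) {O O' : Set X} (h : O' ⊆ O) : R.dom s O' ⊆ R.dom s O :=
  fun _ hx ↦ ⟨hx.1, h hx.2⟩

theorem continuousOn_gram (s : R.Cell) : ContinuousOn (R.gram s) (closedSimplex m) := by
  refine continuousOn_pi.2 fun i ↦ continuousOn_pi.2 fun j ↦ ?_
  exact (R.g_cont s.1 s.2.1 s.2.2 _ (R.edge_mem_vectorSpan s i) _
    (R.edge_mem_vectorSpan s j)).comp (R.continuous_chart s).continuousOn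
    fun x hx ↦ R.chart_mem_convexHull s hx

theorem gram_isSymm (s : R.Cell) {x : EuclideanSpace ℝ (Fin m)} (hx : x ∈ closedSimplex m) :
    (R.gram s x).IsSymm := by
  ext i j
  exact R.g_symm s.1 s.2.1 s.2.2 _ (R.chart_mem_convexHull s hx) _
    (R.edge_mem_vectorSpan s j) _ (R.edge_mem_vectorSpan s i)

theorem gradInner_comm (s : R.Cell) {x : EuclideanSpace ℝ (Fin m)} (hx : x ∈ closedSimplex m)
    (a b : EuclideanSpace ℝ (Fin m)) : R.gradInner s x a b = R.gradInner s x b a := by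
  have h : ((R.gram s x)⁻¹).IsSymm := by
    rw [Matrix.IsSymm, Matrix.transpose_nonsing_inv, (R.gram_isSymm s hx).eq]
  unfold gradInner
  rw [Finset.sum_comm]
  refine Finset.sum_congr rfl fun i _ ↦ Finset.sum_congr rfl fun j _ ↦ ?_
  rw [h.apply]
  ring

theorem gradInner_add_left (s : R.Cell) (x a a' b : EuclideanSpace ℝ (Fin m)) :
    R.gradInner s x (a + a') b = R.gradInner s x a b + R.gradInner s x a' b := by
  simp only [gradInner, ← Finset.sum_add_distrib, PiLp.add_apply]
  exact Finset.sum_congr rfl fun i _ ↦ Finset.sum_congr rfl fun j _ ↦ by ring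

theorem gradInner_add_right (s : R.Cell) (x a b b' : EuclideanSpace ℝ (Fin m)) :
    R.gradInner s x a (b + b') = R.gradInner s x a b + R.gradInner s x a b' := by
  simp only [gradInner, ← Finset.sum_add_distrib, PiLp.add_apply]
  exact Finset.sum_congr rfl fun i _ ↦ Finset.sum_congr rfl fun j _ ↦ by ring

theorem t2Space {X : Type*} [TopologicalSpace X] {m : ℕ} (R : RiemannianPolyhedron X m) :
    T2Space X :=
  R.θ.t2Space

theorem isCompact_toV_image {C : Set X} (hC : IsCompact C) : IsCompact (R.toV '' C) :=
  hC.image (continuous_subtype_val.comp R.θ.symm.continuous)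

/-- A compact set meets only finitely many maximal simplices, by local finiteness. -/
theorem finite_cell_inter {C : Set X} (hC : IsCompact C) :
    {s : R.Cell | (convexHull ℝ (s.1 : Set R.V) ∩ R.toV '' C).Nonempty}.Finite := by
  have h : {s ∈ R.K.faces |
      (convexHull ℝ (s : Set (EuclideanSpace ℝ (Fin R.d))) ∩ R.toV '' C).Nonempty}.Finite := by
    refine (R.isCompact_toV_image hC).induction_on
      (p := fun U ↦ {s ∈ R.K.faces | (convexHull ℝ (s : Set R.V) ∩ U).Nonempty}.Finite)
      (by simp) ?_ ?_ ?_
    · intro U U' hUU' hU'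
      exact hU'.subset fun s hs ↦ ⟨hs.1, hs.2.mono (inter_subset_inter_right _ hUU')⟩
    · intro U U' hU hU'
      refine (hU.union hU').subset fun s hs ↦ ?_
      have := hs.2
      rw [inter_union_distrib_left, union_nonempty] at this
      exact this.imp (fun h ↦ ⟨hs.1, h⟩) fun h ↦ ⟨hs.1, h⟩
    · rintro _ ⟨q, -, rfl⟩
      obtain ⟨U, hU, hfin⟩ := R.locallyFinite (R.toV q) (R.θ.symm q).2
      exact ⟨U, mem_nhdsWithin_of_mem_nhds hU, hfin⟩
  refine Set.Finite.of_finite_image (f := Subtype.val) (h.subset ?_)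
    Subtype.val_injective.injOn
  rintro _ ⟨s, hs, rfl⟩
  exact ⟨s.2.1, hs⟩

/-- Compact sets have finite volume: they meet finitely many maximal simplices, and the density
`√(det g_ij)` is bounded on each, being continuous up to the boundary. -/
theorem vol_lt_top_of_isCompact [MeasurableSpace X] [BorelSpace X] {C : Set X}
    (hC : IsCompact C) : R.vol C < ⊤ := by
  have := R.t2Space
  have hCm : MeasurableSet C := hC.isClosed.measurableSet
  set ν : R.Cell → Measure (EuclideanSpace ℝ (Fin m)) := fun s ↦
    (volume.restrict (openSimplex m)).withDensity
      fun x ↦ ENNReal.ofReal (Real.sqrt (R.gram s x).det) with hν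
  have hae : ∀ s, AEMeasurable (R.pt s) (ν s) := fun s ↦
    ((R.continuousOn_pt s).aemeasurable isOpen_openSimplex.measurableSet).mono_ac
      (withDensity_absolutelyContinuous _ _)
  have hfin : ∀ s, ν s univ < ⊤ := by
    intro s
    rw [hν, withDensity_apply _ MeasurableSet.univ, Measure.restrict_univ]
    have hc : ContinuousOn (fun x ↦ Real.sqrt (R.gram s x).det) (closedSimplex m) :=
      Real.continuous_sqrt.comp_continuousOn
        ((continuous_id.matrix_det).comp_continuousOn (R.continuousOn_gram s))
    exact ((hc.integrableOn_compact isCompact_closedSimplex).mono_set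
      openSimplex_subset_closedSimplex).lintegral_lt_top
  have hzero : ∀ s : R.Cell, ¬ (convexHull ℝ (s.1 : Set R.V) ∩ R.toV '' C).Nonempty →
      Measure.map (R.pt s) (ν s) C = 0 := by
    intro s hs
    rw [Measure.map_apply_of_aemeasurable (hae s) hCm]
    refine withDensity_absolutelyContinuous _ _ ?_
    rw [Measure.restrict_apply' isOpen_openSimplex.measurableSet]
    refine measure_mono_null (fun x hx ↦ hs ⟨R.chart s x, ?_, R.pt s x, hx.1, ?_⟩) measure_empty
    · exact R.chart_mem_convexHull s (openSimplex_subset_closedSimplex hx.2)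
    · exact R.toV_pt s (openSimplex_subset_closedSimplex hx.2)
  have hF := R.finite_cell_inter hC
  rw [vol, Measure.sum_apply _ hCm, tsum_eq_sum (s := hF.toFinset)
    (fun s hs ↦ hzero s (by simpa using hs))]
  refine ENNReal.sum_lt_top.2 fun s _ ↦ ?_
  rw [Measure.map_apply_of_aemeasurable (hae s) hCm]
  exact (measure_mono (subset_univ _)).trans_lt (hfin s)

end RiemannianPolyhedron

/-! ### Energy of compositions -/

section Energy

variable {X : Type*} [TopologicalSpace X] [MeasurableSpace X] {m : ℕ}
  {R : RiemannianPolyhedron X m} {n p : ℕ} {N : Type*} [TopologicalSpace N]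
  [ChartedSpace (EuclideanSpace ℂ (Fin n)) N]
  [RiemannianBundle (fun x : N ↦ TangentSpace 𝓘(ℝ, EuclideanSpace ℂ (Fin n)) x)]
  {P : Type*} [TopologicalSpace P]
  [ChartedSpace (EuclideanSpace ℂ (Fin p)) P]
  [RiemannianBundle (fun x : P ↦ TangentSpace 𝓘(ℝ, EuclideanSpace ℂ (Fin p)) x)]

theorem approxEnergyDensity_le_mul [OpensMeasurableSpace X] {φ : X → N} {φ' : X → P}
    {U U₀ : Set X} (hU : IsOpen U) (hUU₀ : U ⊆ U₀) {C : ℝ≥0}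
    (hC : ∀ a ∈ U, ∀ b ∈ U, ndist p (φ' a) (φ' b) ≤ C * ndist n (φ a) (φ b)) (ε : ℝ) {a : X}
    (ha : a ∈ U) :
    approxEnergyDensity R p φ' U ε a ≤ (C : ℝ≥0∞) ^ 2 * approxEnergyDensity R n φ U₀ ε a := by
  unfold approxEnergyDensity
  rw [← lintegral_const_mul' _ _ (ENNReal.pow_ne_top ENNReal.coe_ne_top)]
  calc ∫⁻ q in {q ∈ U | R.xdist a q < ENNReal.ofReal ε},
        ndist p (φ' a) (φ' q) ^ 2 / ENNReal.ofReal (ε ^ (m + 2)) ∂(R.vol)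
      ≤ ∫⁻ q in {q ∈ U | R.xdist a q < ENNReal.ofReal ε},
        (C : ℝ≥0∞) ^ 2 * (ndist n (φ a) (φ q) ^ 2 / ENNReal.ofReal (ε ^ (m + 2))) ∂(R.vol) := by
        refine lintegral_mono_ae ?_
        -- the ball need not be measurable, but it is contained in the open set `U`
        refine ae_restrict_of_ae_restrict_of_subset (t := U) (fun q hq ↦ hq.1) ?_
        filter_upwards [ae_restrict_mem hU.measurableSet] with q hq
        rw [← mul_div_assoc, ← mul_pow]
        gcongr
        exact hC a ha q hq
    _ ≤ _ := by
        refine lintegral_mono_set ?_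
        exact fun q hq ↦ ⟨hUU₀ hq.1, hq.2⟩

/-- Post-composition with a `C`-Lipschitz map multiplies the energy by at most `C²`, and the energy
is monotone in the open set: the functions `f` cut off inside `U` are also admissible in `U₀`. -/
theorem energyOn_le_mul [OpensMeasurableSpace X] {φ : X → N} {φ' : X → P} {U U₀ : Set X}
    (hU : IsOpen U) (hUU₀ : U ⊆ U₀) {C : ℝ≥0}
    (hC : ∀ a ∈ U, ∀ b ∈ U, ndist p (φ' a) (φ' b) ≤ C * ndist n (φ a) (φ b)) :
    energyOn R p φ' U ≤ (C : ℝ≥0∞) ^ 2 * energyOn R n φ U₀ := by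
  have hC2 : (C : ℝ≥0∞) ^ 2 ≠ ⊤ := ENNReal.pow_ne_top ENNReal.coe_ne_top
  refine iSup_le fun f ↦ iSup_le fun hf ↦ iSup_le fun hf1 ↦ iSup_le fun hfc ↦
    iSup_le fun hfU ↦ ?_
  have hle : limsup (fun ε : ℝ ↦ ∫⁻ a in U₀, f a * approxEnergyDensity R n φ U₀ ε a ∂(R.vol))
      (𝓝[>] 0) ≤ energyOn R n φ U₀ :=
    le_iSup_of_le f (le_iSup_of_le hf (le_iSup_of_le hf1 (le_iSup_of_le hfc
      (le_iSup_of_le (hfU.trans hUU₀) le_rfl))))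
  calc _ ≤ limsup (fun ε : ℝ ↦ (C : ℝ≥0∞) ^ 2 *
        ∫⁻ a in U₀, f a * approxEnergyDensity R n φ U₀ ε a ∂(R.vol)) (𝓝[>] 0) := by
        refine limsup_le_limsup (Eventually.of_forall fun ε ↦ ?_)
        simp only
        rw [← lintegral_const_mul' _ _ hC2]
        calc _ ≤ ∫⁻ a in U, (C : ℝ≥0∞) ^ 2 *
              (f a * approxEnergyDensity R n φ U₀ ε a) ∂(R.vol) := by
              refine setLIntegral_mono' hU.measurableSet fun a ha ↦ ?_
              calc _ ≤ f a * ((C : ℝ≥0∞) ^ 2 * approxEnergyDensity R n φ U₀ ε a) := by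
                    gcongr
                    exact approxEnergyDensity_le_mul hU hUU₀ hC ε ha
                _ = _ := by ring
          _ ≤ _ := lintegral_mono_set hUU₀
    _ = (C : ℝ≥0∞) ^ 2 * limsup (fun ε : ℝ ↦
        ∫⁻ a in U₀, f a * approxEnergyDensity R n φ U₀ ε a ∂(R.vol)) (𝓝[>] 0) :=
        ENNReal.limsup_const_mul_of_ne_top hC2
    _ ≤ _ := by gcongr

/-- Post-composition with a holomorphic map preserves `W^{1,2}_loc`. Every point has a neighbourhood
in `φ⁻¹(A)` on which `ψ` acts as a Lipschitz map and `ψ ∘ φ` stays in a unit ball, so that the energy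
is finite and `ψ ∘ φ` is square integrable on compact sets, these having finite volume. -/
theorem MemW12LocOn.comp_of_mdifferentiableOn [BorelSpace X] [T2Space N] [T2Space P]
    [SecondCountableTopology P] [IsHermitianManifold n N] [IsHermitianManifold p P] {φ : X → N}
    (hφ : Continuous φ) (hW : MemW12LocOn R n φ univ) {A : Set N} {ψ : N → P} (hA : IsOpen A)
    (hψ : MDifferentiableOn 𝓘(ℂ, EuclideanSpace ℂ (Fin n)) 𝓘(ℂ, EuclideanSpace ℂ (Fin p)) ψ A) :
    MemW12LocOn R p (ψ ∘ φ) (φ ⁻¹' A) := by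
  intro q hq
  have hqA : φ q ∈ A := hq
  obtain ⟨U₀, hU₀, hqU₀, -, -, hE⟩ := hW q (mem_univ q)
  obtain ⟨C, W, hWn, hC⟩ := exists_ndist_le_mul_of_mdifferentiableOn hA hψ hqA
  have hψq : ∀ᶠ y in 𝓝 (φ q), ndist p (ψ y) (ψ (φ q)) < 1 :=
    (hψ.continuousOn.continuousAt (hA.mem_nhds hqA)).eventually (eventually_ndist_lt_one _)
  obtain ⟨W', hW', hW'o, hqW'⟩ := mem_nhds_iff.1 (inter_mem hWn hψq)
  set U := U₀ ∩ φ ⁻¹' (A ∩ W') with hUdef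
  have hU : IsOpen U := hU₀.inter ((hA.inter hW'o).preimage hφ)
  refine ⟨U, hU, ⟨hqU₀, hqA, hqW'⟩, fun a ha ↦ ha.2.1, ⟨?_, ψ (φ q), ?_⟩, ?_⟩
  · have : TopologicalSpace.MetrizableSpace P :=
      have : LocallyCompactSpace P :=
        Manifold.locallyCompact_of_finiteDimensional 𝓘(ℝ, EuclideanSpace ℂ (Fin p))
      TopologicalSpace.metrizableSpace_of_t3_secondCountable P
    refine ContinuousOn.aestronglyMeasurable ?_ hU.measurableSet
    exact hψ.continuousOn.comp hφ.continuousOn fun a ha ↦ ha.2.1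
  · intro K hK hKU
    have := R.t2Space
    calc ∫⁻ a in K, ndist p ((ψ ∘ φ) a) (ψ (φ q)) ^ 2 ∂(R.vol) ≤ ∫⁻ a in K, 1 ∂(R.vol) := by
          refine setLIntegral_mono' hK.isClosed.measurableSet fun a ha ↦ ?_
          exact pow_le_one₀ zero_le (hW' (hKU ha).2.2).2.le
      _ < ⊤ := by
          rw [setLIntegral_one]
          exact R.vol_lt_top_of_isCompact hK
  · refine (energyOn_le_mul hU inter_subset_left (φ := φ) (n := n) (C := C)
      fun a ha b hb ↦ ?_).trans_lt
      (ENNReal.mul_lt_top (ENNReal.pow_lt_top ENNReal.coe_lt_top) hE)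
    exact hC _ (hW' ha.2.2).1 _ (hW' hb.2.2).1

end Energy

/-! ### Weak differentials -/

namespace RiemannianPolyhedron.IsWeakDiff

variable {X : Type*} [TopologicalSpace X] {m : ℕ} {R : RiemannianPolyhedron X m}
  {O O' : Set X} {u u' : X → ℝ} {s : R.Cell}
  {D D' : EuclideanSpace ℝ (Fin m) → EuclideanSpace ℝ (Fin m)}

theorem mono (h : R.IsWeakDiff O u s D) (hO : O' ⊆ O) : R.IsWeakDiff O' u s D where
  locInt := h.locInt.mono_set (R.dom_mono s hO)
  locInt_diff := h.locInt_diff.mono_set (R.dom_mono s hO)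
  byParts η hη hηc hηO := h.byParts η hη hηc (hηO.trans (R.dom_mono s hO))

theorem congr (h : R.IsWeakDiff O u s D) (hO : IsOpen O) (huu' : EqOn u u' O) :
    R.IsWeakDiff O u' s D where
  locInt := by
    refine h.locInt.congr ?_
    filter_upwards [ae_restrict_mem (R.isOpen_dom s hO).measurableSet] with x hx
    exact huu' hx.2
  locInt_diff := h.locInt_diff
  byParts η hη hηc hηO i := by
    rw [← h.byParts η hη hηc hηO i]
    refine integral_congr_ae (Eventually.of_forall fun x ↦ ?_)
    by_cases hx : x ∈ tsupport η
    · simp only [huu' (hηO hx).2]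
    · have : fderiv ℝ η x = 0 := by
        by_contra h0
        exact hx (support_fderiv_subset ℝ h0)
      simp [this]

theorem integrable_mul_of_support_subset {f g : EuclideanSpace ℝ (Fin m) → ℝ}
    {K : Set (EuclideanSpace ℝ (Fin m))} (hK : IsCompact K) (hf : IntegrableOn f K)
    (hg : Continuous g) (hgK : Function.support g ⊆ K) : Integrable fun x ↦ f x * g x := by
  rw [← integrableOn_iff_integrable_of_support_subset
    ((Function.support_mul_subset_right f g).trans hgK)]
  exact hf.mul_continuousOn hg.continuousOn hK

theorem add (h : R.IsWeakDiff O u s D) (h' : R.IsWeakDiff O u' s D') :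
    R.IsWeakDiff O (fun q ↦ u q + u' q) s (fun x ↦ D x + D' x) where
  locInt := h.locInt.add h'.locInt
  locInt_diff := h.locInt_diff.add h'.locInt_diff
  byParts η hη hηc hηO i := by
    have hcη : Continuous fun x ↦ fderiv ℝ η x (EuclideanSpace.single i 1) :=
      (hη.continuous_fderiv (by simp)).clm_apply continuous_const
    have hsη : (Function.support fun x ↦ fderiv ℝ η x (EuclideanSpace.single i 1)) ⊆
        tsupport η := fun x hx ↦ support_fderiv_subset ℝ fun h0 ↦ hx (by simp [h0])
    have key {v : X → ℝ} {F : EuclideanSpace ℝ (Fin m) → EuclideanSpace ℝ (Fin m)}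
        (hv : R.IsWeakDiff O v s F) :
        Integrable (fun x ↦ v (R.pt s x) * fderiv ℝ η x (EuclideanSpace.single i 1)) ∧
          Integrable (fun x ↦ F x i * η x) := by
      refine ⟨integrable_mul_of_support_subset hηc
        (hv.locInt.integrableOn_compact_subset hηO hηc) hcη hsη,
        integrable_mul_of_support_subset hηc ?_ hη.continuous (subset_tsupport η)⟩
      exact (EuclideanSpace.proj (𝕜 := ℝ) i).integrable_comp
        (hv.locInt_diff.integrableOn_compact_subset hηO hηc)
    simp only [add_mul, PiLp.add_apply]
    rw [integral_add (key h).1 (key h').1, integral_add (key h).2 (key h').2,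
      h.byParts η hη hηc hηO i, h'.byParts η hη hηc hηO i, neg_add]

end RiemannianPolyhedron.IsWeakDiff

/-! ### Conformality -/

section Conformal

variable {X : Type*} [TopologicalSpace X] [MeasurableSpace X] {m : ℕ}
  {R : RiemannianPolyhedron X m} {n p : ℕ} {N : Type*} [TopologicalSpace N]
  [ChartedSpace (EuclideanSpace ℂ (Fin n)) N]
  {P : Type*} [TopologicalSpace P]
  [ChartedSpace (EuclideanSpace ℂ (Fin p)) P]
  [RiemannianBundle (fun x : P ↦ TangentSpace 𝓘(ℝ, EuclideanSpace ℂ (Fin p)) x)]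

/-- Post-composition with a holomorphic map preserves pseudo-horizontally weakly conformal maps,
since it pulls local holomorphic functions back to local holomorphic functions. -/
theorem IsPHWCOn.comp_of_mdifferentiableOn [BorelSpace X]
    [RiemannianBundle (fun x : N ↦ TangentSpace 𝓘(ℝ, EuclideanSpace ℂ (Fin n)) x)]
    [T2Space N] [T2Space P] [SecondCountableTopology P]
    [IsHermitianManifold n N] [IsHermitianManifold p P] {φ : X → N}
    (hφ : Continuous φ) (h : IsPHWCOn R n φ univ) {A : Set N} {ψ : N → P} (hA : IsOpen A)
    (hψ : MDifferentiableOn 𝓘(ℂ, EuclideanSpace ℂ (Fin n)) 𝓘(ℂ, EuclideanSpace ℂ (Fin p)) ψ A) :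
    IsPHWCOn R p (ψ ∘ φ) (φ ⁻¹' A) where
  continuousOn := hψ.continuousOn.comp hφ.continuousOn fun _ ha ↦ ha
  memW12Loc := h.memW12Loc.comp_of_mdifferentiableOn hφ hA hψ
  conformal B B' v w hB hB' hv hw s dv₁ dv₂ dw₁ dw₂ hv₁ hv₂ hw₁ hw₂ := by
    have hset : φ ⁻¹' A ∩ (ψ ∘ φ) ⁻¹' (B ∩ B') =
        univ ∩ φ ⁻¹' ((A ∩ ψ ⁻¹' B) ∩ (A ∩ ψ ⁻¹' B')) := by
      ext a
      simp only [mem_inter_iff, mem_preimage, Function.comp_apply, mem_univ, true_and]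
      tauto
    rw [hset] at hv₁ hv₂ hw₁ hw₂ ⊢
    exact h.conformal (A ∩ ψ ⁻¹' B) (A ∩ ψ ⁻¹' B') (v ∘ ψ) (w ∘ ψ)
      (hψ.continuousOn.isOpen_inter_preimage hA hB)
      (hψ.continuousOn.isOpen_inter_preimage hA hB')
      (hv.comp (hψ.mono inter_subset_left) fun _ ha ↦ ha.2)
      (hw.comp (hψ.mono inter_subset_left) fun _ ha ↦ ha.2) s dv₁ dv₂ dw₁ dw₂ hv₁ hv₂ hw₁ hw₂

/-- If all compositions of `φ` with holomorphic maps into `P` are pseudo-horizontally weakly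
conformal, then `φ` satisfies the conformality relations for pairs `(h, h)`. Where `|h|` is bounded,
a rescaling of `h` is the first coordinate of a holomorphic map into a chart domain of `P`, and the
relations for the first coordinate function of the chart are those for `h`. -/
theorem ae_gradInner_self_of_forall_comp [IsManifold 𝓘(ℂ, EuclideanSpace ℂ (Fin p)) ω P]
    [Nonempty P] (hp : 1 ≤ p) {φ : X → N} (hφ : Continuous φ)
    (H : ∀ (A : Set N) (ψ : N → P), IsOpen A →
      MDifferentiableOn 𝓘(ℂ, EuclideanSpace ℂ (Fin n)) 𝓘(ℂ, EuclideanSpace ℂ (Fin p)) ψ A →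
      IsPHWCOn R p (ψ ∘ φ) (φ ⁻¹' A))
    {A : Set N} {h : N → ℂ} (hA : IsOpen A)
    (hh : MDifferentiableOn 𝓘(ℂ, EuclideanSpace ℂ (Fin n)) 𝓘(ℂ, ℂ) h A) {s : R.Cell}
    {d₁ d₂ : EuclideanSpace ℝ (Fin m) → EuclideanSpace ℝ (Fin m)}
    (h₁ : R.IsWeakDiff (φ ⁻¹' A) (fun q ↦ (h (φ q)).re) s d₁)
    (h₂ : R.IsWeakDiff (φ ⁻¹' A) (fun q ↦ (h (φ q)).im) s d₂) :
    ∀ᵐ x : EuclideanSpace ℝ (Fin m), x ∈ R.dom s (φ ⁻¹' A) →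
      R.gradInner s x (d₁ x) (d₁ x) - R.gradInner s x (d₂ x) (d₂ x) = 0 ∧
      R.gradInner s x (d₂ x) (d₁ x) + R.gradInner s x (d₁ x) (d₂ x) = 0 := by
  obtain ⟨q₀⟩ := ‹Nonempty P›
  let i₀ : Fin p := ⟨0, hp⟩
  set e := chartAt (EuclideanSpace ℂ (Fin p)) q₀ with he
  set c := e q₀ with hc
  obtain ⟨r, hr, hball⟩ := Metric.mem_nhds_iff.1 (chart_target_mem_nhds
    (EuclideanSpace ℂ (Fin p)) q₀)
  have hbounded : ∀ k : ℕ, ∀ᵐ x : EuclideanSpace ℝ (Fin m),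
      x ∈ R.dom s (φ ⁻¹' (A ∩ h ⁻¹' Metric.ball 0 (k + 1))) →
      R.gradInner s x (d₁ x) (d₁ x) - R.gradInner s x (d₂ x) (d₂ x) = 0 ∧
      R.gradInner s x (d₂ x) (d₁ x) + R.gradInner s x (d₁ x) (d₂ x) = 0 := by
    intro k
    set A' := A ∩ h ⁻¹' Metric.ball 0 (k + 1) with hA'def
    have hA' : IsOpen A' := hh.continuousOn.isOpen_inter_preimage hA Metric.isOpen_ball
    have hk : (0 : ℝ) < k + 1 := by positivity
    set t : ℝ := r / (k + 1) with ht
    have ht0 : 0 < t := by positivity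
    -- `L` maps the disk of radius `k + 1` into the ball of radius `r` around `c`
    let L : ℂ → EuclideanSpace ℂ (Fin p) := fun z ↦
      c + ((t : ℂ) * z) • EuclideanSpace.single i₀ (1 : ℂ)
    have hL : Differentiable ℂ L := by fun_prop
    have hLt : ∀ y ∈ A', L (h y) ∈ e.target := by
      intro y hy
      apply hball
      have hy' : ‖h y‖ < k + 1 := by simpa using hy.2
      rw [Metric.mem_ball, dist_eq_norm, add_sub_cancel_left, norm_smul, norm_mul,
        Complex.norm_of_nonneg ht0.le]
      simp only [PiLp.norm_single, norm_one, mul_one]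
      calc t * ‖h y‖ < t * (k + 1) := by gcongr
        _ = r := div_mul_cancel₀ _ hk.ne'
    let ψ : N → P := fun y ↦ e.symm (L (h y))
    have hψ : MDifferentiableOn 𝓘(ℂ, EuclideanSpace ℂ (Fin n)) 𝓘(ℂ, EuclideanSpace ℂ (Fin p))
        ψ A' :=
      (mdifferentiableOn_atlas_symm (chart_mem_atlas _ q₀)).comp
        (hL.mdifferentiable.comp_mdifferentiableOn (hh.mono inter_subset_left)) hLt
    -- `v` is normalized so that `v ∘ ψ = h` without a constant
    let v : P → ℂ := fun z ↦ (t : ℂ)⁻¹ * (e z i₀ - c i₀)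
    have hv : MDifferentiableOn 𝓘(ℂ, EuclideanSpace ℂ (Fin p)) 𝓘(ℂ, ℂ) v e.source := by
      have hd : Differentiable ℂ fun a : EuclideanSpace ℂ (Fin p) ↦
          (t : ℂ)⁻¹ * (a i₀ - c i₀) := by fun_prop
      exact hd.mdifferentiable.comp_mdifferentiableOn
        (mdifferentiableOn_atlas (chart_mem_atlas _ q₀))
    have hvψ : ∀ y ∈ A', h y = v (ψ y) := by
      intro y hy
      have ht' : (t : ℂ) ≠ 0 := by exact_mod_cast ht0.ne'
      simp only [v, ψ, e.right_inv (hLt y hy), L, PiLp.add_apply, PiLp.smul_apply,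
        PiLp.single_apply, if_true, smul_eq_mul, mul_one, add_sub_cancel_left]
      field_simp
    have hset : φ ⁻¹' A' ∩ (ψ ∘ φ) ⁻¹' (e.source ∩ e.source) = φ ⁻¹' A' :=
      inter_eq_left.2 fun a ha ↦ ⟨e.map_target (hLt _ ha), e.map_target (hLt _ ha)⟩
    have hsub : φ ⁻¹' A' ⊆ φ ⁻¹' A := fun a ha ↦ ha.1
    have hw₁ : R.IsWeakDiff (φ ⁻¹' A') (fun q ↦ (v ((ψ ∘ φ) q)).re) s d₁ :=
      (h₁.mono hsub).congr (hA'.preimage hφ) fun a ha ↦ congrArg Complex.re (hvψ _ ha)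
    have hw₂ : R.IsWeakDiff (φ ⁻¹' A') (fun q ↦ (v ((ψ ∘ φ) q)).im) s d₂ :=
      (h₂.mono hsub).congr (hA'.preimage hφ) fun a ha ↦ congrArg Complex.im (hvψ _ ha)
    have := (H A' ψ hA' hψ).conformal e.source e.source v v e.open_source e.open_source hv hv s
      d₁ d₂ d₁ d₂
    rw [hset] at this
    exact this hw₁ hw₂ hw₁ hw₂
  -- the sets `{|h| < k + 1}` exhaust the domain of `h`
  filter_upwards [ae_all_iff.2 hbounded] with x hx hxA
  obtain ⟨k, hk⟩ := exists_nat_gt ‖h (φ (R.pt s x))‖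
  refine hx k ⟨hxA.1, hxA.2, ?_⟩
  simpa using hk.trans (lt_add_one _)

end Conformal

end

theorem proposition3p6
    {X : Type*} [TopologicalSpace X] [MeasurableSpace X] [BorelSpace X] {m : ℕ}
    (R : RiemannianPolyhedron X m) (hR : R.Admissible)
    {n p : ℕ} (hp : 1 ≤ p)
    {N : Type*} [TopologicalSpace N] [T2Space N] [SecondCountableTopology N]
    [ChartedSpace (EuclideanSpace ℂ (Fin n)) N]
    [RiemannianBundle (fun x : N ↦ TangentSpace 𝓘(ℝ, EuclideanSpace ℂ (Fin n)) x)]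
    [IsHermitianManifold n N]
    {P : Type*} [TopologicalSpace P] [T2Space P] [SecondCountableTopology P] [Nonempty P]
    [ChartedSpace (EuclideanSpace ℂ (Fin p)) P]
    [RiemannianBundle (fun x : P ↦ TangentSpace 𝓘(ℝ, EuclideanSpace ℂ (Fin p)) x)]
    [IsHermitianManifold p P]
    (φ : X → N) (hφ : Continuous φ) (hW : MemW12LocOn R n φ univ) :
    IsPHWCOn R n φ univ ↔
      ∀ (A : Set N) (ψ : N → P), IsOpen A →
        MDifferentiableOn 𝓘(ℂ, EuclideanSpace ℂ (Fin n)) 𝓘(ℂ, EuclideanSpace ℂ (Fin p)) ψ A →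
        IsPHWCOn R p (ψ ∘ φ) (φ ⁻¹' A) := by
  refine ⟨fun h A ψ hA hψ ↦ h.comp_of_mdifferentiableOn hφ hA hψ,
    fun H ↦ ⟨hφ.continuousOn, hW, ?_⟩⟩
  intro A B v w hA hB hv hw s dv₁ dv₂ dw₁ dw₂ hv₁ hv₂ hw₁ hw₂
  rw [univ_inter] at hv₁ hv₂ hw₁ hw₂ ⊢
  have hv' := hv.mono (inter_subset_left (t := B))
  have hw' := hw.mono (inter_subset_right (s := A))
  have hAB := hA.inter hB
  -- polarization: the symmetric complex bilinear form vanishing on the differentials of `v`, `w` and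
  -- `v + w` vanishes on the pair `(v, w)`
  have hvw := hv'.add hw'
  filter_upwards [ae_gradInner_self_of_forall_comp hp hφ H hAB hv' hv₁ hv₂,
    ae_gradInner_self_of_forall_comp hp hφ H hAB hw' hw₁ hw₂,
    ae_gradInner_self_of_forall_comp hp hφ H hAB hvw (hv₁.add hw₁) (hv₂.add hw₂)]
    with x h₁ h₂ h₃ hx
  obtain ⟨a₁, b₁⟩ := h₁ hx
  obtain ⟨a₂, b₂⟩ := h₂ hx
  obtain ⟨a₃, b₃⟩ := h₃ hx
  have hcomm := R.gradInner_comm s (RiemannianPolyhedron.openSimplex_subset_closedSimplex hx.1)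
  simp only [R.gradInner_add_left, R.gradInner_add_right] at a₃ b₃
  constructor
  · linarith [hcomm (dv₁ x) (dw₁ x), hcomm (dv₂ x) (dw₂ x)]
  · linarith [hcomm (dv₁ x) (dw₂ x), hcomm (dv₂ x) (dw₁ x)]
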